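/- **Conventions.** Points $p,q\in\mathbb Z^2$ are $c_1$-adjacent if $|p_1-q_1|+|p_2-q_2|=1$, and $c_2$-adjacent if $p\ne q$ and $|p_1-q_1|\le 1$, $|p_2-q_2|\le 1$; they are *diagonal neighbours* if they are $c_2$- but not $c_1$-adjacent. For $X\subseteq\mathbb Z^2$, a map $f:X\to X$ is $c_1$-*continuous* if it maps $c_1$-connected subsets of $X$ to $c_1$-connected sets. A set $A\subseteq X$ is a *freezing set* for $(X,c_1)$ if the identity is the only $c_1$-continuous $f:X\to X$ with $f(a)=a$ for all $a\in A$; it is a *cold set* (1-cold set) for $(X,c_1)$ if every $c_1$-continuous $f:X\to X$ with $f(a)=a$ for all $a\in A$ satisfies $d_{c_1}(x,f(x))\le 1$ for all $x\in X$, where $d_{c_1}$ is the length of a shortest $c_1$-path in $X$. A *$c_2$-closed curve* is a finite cyclic sequence $S$ of distinct points of $\mathbb Z^2$ in which consecutive points are $c_2$-adjacent. It is a *bounding curve* of $X$ if $\mathbb Z^2\setminus S$ has exactly two $c_1$-components, a finite one $\mathrm{Int}(S)$ and an infinite one, and $X=S\cup \mathrm{Int}(S)$; then $X$ is a *digital disk*.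 A *digital line segment* is a finite $c_1$- or $c_2$-connected set of at least two points that are collinear. The *sides* of $S$ are the maximal digital line segments formed by points that are consecutive along $S$; a segment is *axis-parallel* if it is horizontal or vertical, and *slanted* if its slope is $\pm1$. Where two sides of $S$ meet in exactly one point $p$, they form an *interior angle* of $S$ at $p$, measured on the side of $\mathrm{Int}(S)$. A digital disk $X$ is *thick* if, for some bounding curve $S$ of $X$: * for every slanted side $\sigma$ of $S$ and every $p\in\sigma$ that is not an endpoint of $\sigma$, some $c\in X\setminus\sigma$ is a diagonal neighbour of $p$; * for every vertex $p$ of an interior angle of $S$ of measure $\pi/2$ there is $q\in \mathrm{Int}(S)$ that is a diagonal neighbour of $p$ if both sides of the angle are axis-parallel, and is $c_1$-adjacent to $p$ if both are slanted; * for every vertex $p$ of an interior angle of $S$ of measure $3\pi/4$ there are $b,b'\in X$ strictly inside the angle such that $b$ is a diagonal neighbour of $p$ and $b'$ is $c_1$-adjacent to $p$. A finite set $Y\subset\mathbb Z^2$ is *digitally convex* if it is a single point, or a digital line segment, or a digital disk with a bounding curve $S$ such that the endpoints of the sides of $S$ are exactly the vertices of the convex hull of $Y$ in $\mathbb R^2$.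 **Theorem.** Let $X\subset\mathbb Z^2$ be a thick, digitally convex digital disk, and let $A\subseteq X$. Then $A$ is a cold set for $(X,c_1)$ if and only if $A$ is a freezing set for $(X,c_1)$. -/

import Mathlib

namespace DigitalImage

/-- The digital plane `ℤ²`. -/
abbrev Plane : Type := ℤ × ℤ

/-- `c₁`-adjacency (4-adjacency) in `ℤ²`. -/
def c1 : SimpleGraph Plane where
  Adj p q := |p.1 - q.1| + |p.2 - q.2| = 1
  symm := ⟨fun p q h => by rwa [abs_sub_comm q.1, abs_sub_comm q.2]⟩
  loopless := ⟨fun p h => by simp at h⟩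

/-- `c₂`-adjacency (8-adjacency) in `ℤ²`. -/
def c2 : SimpleGraph Plane where
  Adj p q := p ≠ q ∧ |p.1 - q.1| ≤ 1 ∧ |p.2 - q.2| ≤ 1
  symm := ⟨fun p q h => by
    rw [abs_sub_comm q.1, abs_sub_comm q.2]
    exact ⟨h.1.symm, h.2⟩⟩
  loopless := ⟨fun p h => h.1 rfl⟩

/-! ### Continuity, freezing sets, cold sets

A digital image `(X, κ)` is a graph; below it is `κ.induce X` on the vertex type `X`. -/

section Maps

variable {V : Type*} (G : SimpleGraph V)

/-- Digital continuity of a self-map: connected subsets have connected images. -/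
def IsContinuous (f : V → V) : Prop :=
  ∀ Y : Set V, (G.induce Y).Preconnected → (G.induce (f '' Y)).Preconnected

/-- `A` is a freezing set. -/
def IsFreezing (A : Set V) : Prop :=
  ∀ f : V → V, IsContinuous G f → (∀ a ∈ A, f a = a) → f = id

/-- `A` is an `s`-cold set. The path-length metric is `SimpleGraph.edist`, which is `⊤` for points
that are not joined by a path. -/
def IsSCold (s : ℕ) (A : Set V) : Prop :=
  ∀ f : V → V, IsContinuous G f → (∀ a ∈ A, f a = a) → ∀ x, G.edist x (f x) ≤ s

/-- A cold set is a 1-cold set. -/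
def IsCold (A : Set V) : Prop := IsSCold G 1 A

end Maps

/-! ### Plane geometry -/

/-- The inclusion of `ℤ²` in the Euclidean plane, taken to be `ℂ`. -/
noncomputable def toC (p : Plane) : ℂ := ⟨(p.1 : ℝ), (p.2 : ℝ)⟩

/-- The counterclockwise angle, in `[0, 2π)`, from the direction of `u` to that of `v`
(for nonzero `u` and `v`). -/
noncomputable def ccwAngle (u v : Plane) : ℝ :=
  toIcoMod Real.two_pi_pos 0 (Complex.arg (toC v / toC u))

/-- A digital line segment: a finite `c₁`- or `c₂`-connected set of more than one point, all of
whose points are collinear. -/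
def IsSegment (Y : Set Plane) : Prop :=
  Y.Finite ∧ Y.Nontrivial ∧ ((c1.induce Y).Connected ∨ (c2.induce Y).Connected) ∧
    Collinear ℝ (toC '' Y)

/-- All slopes between points of `Y` are `±1`. -/
def IsSlanted (Y : Set Plane) : Prop :=
  ∀ p ∈ Y, ∀ q ∈ Y, |p.1 - q.1| = |p.2 - q.2|

/-- `Y` is contained in a horizontal or a vertical line. -/
def IsAxisParallel (Y : Set Plane) : Prop :=
  (∀ p ∈ Y, ∀ q ∈ Y, p.1 = q.1) ∨ (∀ p ∈ Y, ∀ q ∈ Y, p.2 = q.2)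

/-! ### Closed curves and disks -/

/-- A `c₂`-closed curve `s₀, s₁, …, s_m = s₀` with `s₀, …, s_{m-1}` distinct, indexed cyclically. -/
structure ClosedCurve where
  /-- the number `m` of points -/
  len : ℕ
  [len_ne_zero : NeZero len]
  /-- the points, in the order in which the curve visits them -/
  pt : ZMod len → Plane
  injective : Function.Injective pt
  step : ∀ i, pt i = pt (i + 1) ∨ c2.Adj (pt i) (pt (i + 1))

attribute [instance] ClosedCurve.len_ne_zero

namespace ClosedCurve

variable (S : ClosedCurve)

/-- The set of points of the curve. -/
def carrier : Set Plane := Set.range S.pt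

/-- The complement of the curve, with `c₁`-adjacency. -/
abbrev complGraph : SimpleGraph ↥(S.carrierᶜ) := c1.induce S.carrierᶜ

/-- `Int(S)`: the points off the curve that lie in a finite `c₁`-component of its complement. -/
def interior : Set Plane :=
  {p | ∃ h : p ∈ S.carrierᶜ, (S.complGraph.connectedComponentMk ⟨p, h⟩).supp.Finite}

/-- `S` is a bounding curve of `X`: the complement of `S` has exactly two `c₁`-components, one
finite and one infinite, and `X` is the union of `S` and the finite one. -/
def IsBoundingCurve (X : Set Plane) : Prop :=
  (∃ C D : S.complGraph.ConnectedComponent,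
    C.supp.Finite ∧ D.supp.Infinite ∧ ∀ E, E = C ∨ E = D) ∧
  X = S.carrier ∪ S.interior

/-- The points `s_i, s_{i+1}, …, s_{i+k}`, consecutive along the curve. -/
def arc (i : ZMod S.len) (k : ℕ) : Set Plane :=
  {p | ∃ j : ℕ, j ≤ k ∧ p = S.pt (i + j)}

/-- The arc from `s_i` to `s_{i+k}` is a side of `S`: it is a digital line segment, and is maximal
among the digital line segments formed by consecutive points of the curve. -/
def IsSide (i : ZMod S.len) (k : ℕ) : Prop :=
  IsSegment (S.arc i k) ∧
    ∀ (i' : ZMod S.len) (k' : ℕ),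
      IsSegment (S.arc i' k') → S.arc i k ⊆ S.arc i' k' → S.arc i' k' = S.arc i k

/-- The endpoints of the sides of `S`. -/
def sideEndpoints : Set Plane :=
  {p | ∃ i k, S.IsSide i k ∧ (p = S.pt i ∨ p = S.pt (i + k))}

/-- `S` runs counterclockwise around `Int(S)`: the total angle that it sweeps out as seen from a
point of `Int(S)` (which is `2π` times the winding number) is positive. -/
def IsCcw : Prop :=
  ∀ q ∈ S.interior, 0 < ∑ i, Complex.arg (toC (S.pt (i + 1) - q) / toC (S.pt i - q))

/-- The direction at `s_i` from which the interior angle there is swept counterclockwise: the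
interior lies to the left of a counterclockwise curve, and to the right of a clockwise one. -/
noncomputable def firstRay (i : ZMod S.len) : Plane :=
  open scoped Classical in
  if S.IsCcw then S.pt (i + 1) - S.pt i else S.pt (i - 1) - S.pt i

/-- The direction at `s_i` at which the interior angle there ends. -/
noncomputable def secondRay (i : ZMod S.len) : Plane :=
  open scoped Classical in
  if S.IsCcw then S.pt (i - 1) - S.pt i else S.pt (i + 1) - S.pt i

/-- The measure of the interior angle at `s_i`. -/
noncomputable def interiorAngle (i : ZMod S.len) : ℝ :=
  ccwAngle (S.firstRay i) (S.secondRay i)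

/-- `z` lies strictly inside the interior angle at `s_i`. -/
def InsideAngle (i : ZMod S.len) (z : Plane) : Prop :=
  0 < ccwAngle (S.firstRay i) (z - S.pt i) ∧
    ccwAngle (S.firstRay i) (z - S.pt i) < S.interiorAngle i

/-- `s_i` is the vertex of an interior angle, formed by the side `s_{i-k}, …, s_i` and the side
`s_i, …, s_{i+l}`. -/
def IsAngle (i : ZMod S.len) (k l : ℕ) : Prop :=
  S.IsSide (i - k) k ∧ S.IsSide i l ∧ S.arc (i - k) k ∩ S.arc i l = {S.pt i}

end ClosedCurve

/-- Diagonal neighbours: `c₂`-adjacent but not `c₁`-adjacent. -/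
def DiagAdj (p q : Plane) : Prop := c2.Adj p q ∧ ¬ c1.Adj p q

/-- `X` is slant-thick at the point `p` of the slanted side `σ`. The diagonal neighbour `c` lies
across the side and not along it: a point `p` of `σ` that is not an endpoint always has two diagonal
neighbours in `σ` itself. -/
def IsSlantThickAt (X σ : Set Plane) (p : Plane) : Prop :=
  ∃ c ∈ X, c ∉ σ ∧ DiagAdj c p

/-- `X`, with bounding curve `S`, is 90°-thick at the vertex `s_i` of the interior angle formed by
the sides `s_{i-k}, …, s_i` and `s_i, …, s_{i+l}`. -/
def Is90ThickAt (S : ClosedCurve) (i : ZMod S.len) (k l : ℕ) : Prop :=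
  ∃ q ∈ S.interior,
    (IsAxisParallel (S.arc (i - k) k) ∧ IsAxisParallel (S.arc i l) → DiagAdj q (S.pt i)) ∧
    (IsSlanted (S.arc (i - k) k) ∧ IsSlanted (S.arc i l) → c1.Adj q (S.pt i))

/-- `X`, with bounding curve `S`, is 135°-thick at the vertex `s_i` of an interior angle. -/
def Is135ThickAt (X : Set Plane) (S : ClosedCurve) (i : ZMod S.len) : Prop :=
  ∃ b ∈ X, ∃ b' ∈ X, S.InsideAngle i b ∧ S.InsideAngle i b' ∧
    DiagAdj b (S.pt i) ∧ c1.Adj b' (S.pt i)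

/-- `X` is a thick digital disk, with the thickness tested on some bounding curve. -/
def IsThickDisk (X : Set Plane) : Prop :=
  ∃ S : ClosedCurve, S.IsBoundingCurve X ∧
    (∀ (i : ZMod S.len) (k : ℕ), S.IsSide i k → IsSlanted (S.arc i k) →
      ∀ p ∈ S.arc i k, p ≠ S.pt i → p ≠ S.pt (i + k) → IsSlantThickAt X (S.arc i k) p) ∧
    (∀ (i : ZMod S.len) (k l : ℕ), S.IsAngle i k l → S.interiorAngle i = Real.pi / 2 →
      Is90ThickAt S i k l) ∧
    (∀ (i : ZMod S.len) (k l : ℕ), S.IsAngle i k l → S.interiorAngle i = 3 * Real.pi / 4 →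
      Is135ThickAt X S i)

/-- Digital convexity: a single point, or a digital line segment, or a digital disk with a bounding
curve whose sides have as their endpoints the vertices of the convex hull. -/
def IsDigitallyConvex (Y : Set Plane) : Prop :=
  (∃ p, Y = {p}) ∨ IsSegment Y ∨
    ∃ S : ClosedCurve, S.IsBoundingCurve Y ∧
      toC '' S.sideEndpoints = (convexHull ℝ (toC '' Y)).extremePoints ℝ

end DigitalImage

namespace DigitalImage

/-! ### Adjacency in coordinates -/

/-! A freezing set is trivially cold. For the converse, call a point `v` of `X` pushable when some
`q` in `X`, neither equal nor adjacent to `v`, is adjacent to every neighbour of `v` in `X`. Sending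
`v` to `q` and fixing all other points is continuous, so a cold set contains every pushable point
(`mem_of_pushable`). A continuous `f` that fixes a cold set pointwise therefore moves points by at
most one and fixes the pushable points; such an `f` is the identity (`Disk.fixed`), as follows.

Convexity provides a bounding curve whose turning points are extreme in `X` (`exists_disk`).
Extremeness leaves a turning point few neighbours, and crossing numbers show which nearby points `X`
must contain. So a turning point is pushable, or it is the sole neighbour of a pushable point `w`
(`Disk.pushable_or_cusp`). In the second case it is fixed too: moving it to `w` would increase its
path distance to another fixed point (`Disk.cusp_fixed`). A point on a straight stretch of the curve
is held in place by the fixed turning points at both ends (`Disk.curve_fixed`). Finally, if `f`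
moved a point `x` off the curve by `e`, it would move `x - e`, `x - 2e`, … by `e` as well; this ray
never meets the fixed curve, hence never leaves the finite set `X`, which is absurd. -/

lemma c1_adj_iff (p q : Plane) : c1.Adj p q ↔
    (q.1 = p.1 + 1 ∧ q.2 = p.2) ∨ (q.1 = p.1 - 1 ∧ q.2 = p.2) ∨
    (q.1 = p.1 ∧ q.2 = p.2 + 1) ∨ (q.1 = p.1 ∧ q.2 = p.2 - 1) := by
  change |p.1 - q.1| + |p.2 - q.2| = 1 ↔ _
  rcases abs_cases (p.1 - q.1) with ⟨h, _⟩ | ⟨h, _⟩ <;>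
  rcases abs_cases (p.2 - q.2) with ⟨h', _⟩ | ⟨h', _⟩ <;> rw [h, h'] <;> omega

lemma c2_adj_iff (p q : Plane) : c2.Adj p q ↔
    (p.1 ≠ q.1 ∨ p.2 ≠ q.2) ∧ -1 ≤ p.1 - q.1 ∧ p.1 - q.1 ≤ 1 ∧
      -1 ≤ p.2 - q.2 ∧ p.2 - q.2 ≤ 1 := by
  change (p ≠ q ∧ |p.1 - q.1| ≤ 1 ∧ |p.2 - q.2| ≤ 1) ↔ _
  rw [abs_le, abs_le, Ne, Prod.ext_iff]
  omega

/-- The `ℓ¹` distance on the digital plane. -/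
def dist1 (p q : Plane) : ℤ := |p.1 - q.1| + |p.2 - q.2|

lemma dist1_triangle (p q r : Plane) : dist1 p r ≤ dist1 p q + dist1 q r := by
  have h1 := abs_sub_le p.1 q.1 r.1
  have h2 := abs_sub_le p.2 q.2 r.2
  simp only [dist1]
  omega

lemma dist1_le_one_iff (p q : Plane) : dist1 p q ≤ 1 ↔ q = p ∨ c1.Adj p q := by
  rw [c1_adj_iff, Prod.ext_iff]
  simp only [dist1]
  rcases abs_cases (p.1 - q.1) with ⟨h, _⟩ | ⟨h, _⟩ <;>
  rcases abs_cases (p.2 - q.2) with ⟨h', _⟩ | ⟨h', _⟩ <;> rw [h, h'] <;> omega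

/-! ### Curves that turn at extreme points -/

/-- The closed curve `t` changes direction at `t i`. -/
def Turn {n : ℕ} (t : ZMod n → Plane) (i : ZMod n) : Prop :=
  t (i + 1) - t i ≠ t i - t (i - 1)

/-- Going forward along a closed curve, one moves straight until the next turning point. -/
lemma exists_turn_of_injective {n : ℕ} {t : ZMod n → Plane} (hn : 2 ≤ n)
    (inj : Function.Injective t) (i : ZMod n) : ∃ K : ℕ, 1 ≤ K ∧ Turn t (i + K) ∧
    ∀ j : ℕ, j ≤ K → t (i + j) = t i + j • (t (i + 1) - t i) := by
  classical
  have key : ∀ K : ℕ, (∀ j : ℕ, 1 ≤ j → j < K → ¬ Turn t (i + j)) →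
      ∀ j : ℕ, j ≤ K → t (i + j) = t i + j • (t (i + 1) - t i) := by
    intro K hK j
    induction j using Nat.strong_induction_on with
    | _ j ih =>
      intro hj
      rcases j with _ | _ | j
      · simp
      · simp
      · have h1 := ih j (by omega) (by omega)
        have h2 := ih (j + 1) (by omega) (by omega)
        have h3 := hK (j + 1) (by omega) (by omega)
        rw [Turn, ne_eq, not_not] at h3
        have e1 : i + ((j + 1 : ℕ) : ZMod n) + 1 = i + ((j + 1 + 1 : ℕ) : ZMod n) := by
          push_cast; ring
        have e2 : i + ((j + 1 : ℕ) : ZMod n) - 1 = i + (j : ZMod n) := by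
          push_cast; ring
        rw [e1, e2, h1, h2, sub_eq_iff_eq_add] at h3
        rw [h3]
        simp only [add_smul, one_smul]
        abel
  have hex : ∃ K : ℕ, 1 ≤ K ∧ Turn t (i + K) := by
    by_contra! h
    -- Without turns the curve is back at its start after `n` equal steps, so that step is zero,
    -- against injectivity.
    have := key n (fun j h1 _ => h j h1) n le_rfl
    rw [ZMod.natCast_self, add_zero, left_eq_add, smul_eq_zero, sub_eq_zero] at this
    rcases this with h | h
    · omega
    · have : Fact (1 < n) := ⟨hn⟩
      simpa using inj h
  refine ⟨Nat.find hex, (Nat.find_spec hex).1, (Nat.find_spec hex).2, key _ ?_⟩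
  intro j h1 h2 h3
  exact Nat.find_min hex h2 ⟨h1, h3⟩

/-- `X` is bounded by the closed curve `t`, all of whose turning points are extreme in `X`. -/
structure Disk {n : ℕ} (t : ZMod n → Plane) (X : Set Plane) : Prop where
  four_le : 4 ≤ n
  inj : Function.Injective t
  step : ∀ i, c2.Adj (t i) (t (i + 1))
  mem : ∀ i, t i ∈ X
  finite : X.Finite
  inside : ∀ p ∈ X, p ∉ Set.range t → ∀ q, c1.Adj p q → q ∈ X
  outside : ∀ W : Plane → ℤ,
    (∀ p q, c1.Adj p q → p ∉ Set.range t → q ∉ Set.range t → W p = W q) →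
    ∀ p, p ∉ X → ∀ q, q ∉ X → W p = W q
  extreme : ∀ i, Turn t i → ∀ (w : Plane) (k l : ℕ), 0 < k → 0 < l →
    t i + k • w ∈ X → t i - l • w ∈ X → w = 0

lemma turn_neg {n : ℕ} {t : ZMod n → Plane} {i : ZMod n} :
    Turn (fun k => t (-k)) i ↔ Turn t (-i) := by
  simp only [Turn, neg_add, neg_sub]
  rw [show (1 : ZMod n) - i = -i + 1 by ring, show -i + -1 = -i - 1 by ring, ne_eq, ne_eq,
    not_iff_not, ← neg_inj, neg_sub, neg_sub, eq_comm]

namespace Disk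

variable {n : ℕ} {t : ZMod n → Plane} {X : Set Plane}

lemma natCast_ne_zero (D : Disk t X) {m : ℕ} (h0 : 0 < m) (h : m ≤ 3) : (m : ZMod n) ≠ 0 := by
  intro e
  rw [ZMod.natCast_eq_zero_iff] at e
  have := Nat.le_of_dvd h0 e
  have := D.four_le
  omega

lemma reverse (D : Disk t X) : Disk (fun k => t (-k)) X where
  four_le := D.four_le
  inj := D.inj.comp neg_injective
  step i := by
    have := (D.step (-i - 1)).symm
    rw [sub_add_cancel] at this
    rwa [← neg_add'] at this
  mem i := D.mem _
  finite := D.finite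
  inside p hp h := D.inside p hp (by
    rintro ⟨i, rfl⟩
    exact h ⟨-i, by simp⟩)
  outside W hW := D.outside W (fun p q h hp hq => hW p q h
    (by rintro ⟨i, rfl⟩; exact hp ⟨_, rfl⟩) (by rintro ⟨i, rfl⟩; exact hq ⟨_, rfl⟩))
  extreme i hi := D.extreme _ (turn_neg.1 hi)

/-- Disks are carried to disks by symmetries of the digital plane. -/
lemma transport (D : Disk t X) (L : Plane ≃+ Plane) (h1 : ∀ p q, c1.Adj (L p) (L q) ↔ c1.Adj p q)
    (h2 : ∀ p q, c2.Adj (L p) (L q) ↔ c2.Adj p q) (v : Plane) :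
    Disk (fun i => L (t i - v)) {p | v + L.symm p ∈ X} := by
  have s1 : ∀ p q : Plane, c1.Adj (v + L.symm p) (v + L.symm q) ↔ c1.Adj p q := by
    intro p q
    rw [← L.apply_symm_apply p, ← L.apply_symm_apply q, h1]
    simp only [c1_adj_iff, Prod.fst_add, Prod.snd_add, AddEquiv.symm_apply_apply]
    omega
  have s1' : ∀ p q : Plane, c1.Adj (L (p - v)) (L (q - v)) ↔ c1.Adj p q := by
    intro p q
    rw [← s1]; simp
  have hr : ∀ p : Plane, L (p - v) ∈ Set.range (fun i => L (t i - v)) ↔ p ∈ Set.range t := by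
    intro p
    simp [Set.mem_range]
  refine ⟨D.four_le, fun i j h => D.inj ?_, fun i => ?_, fun i => ?_, ?_, ?_, ?_, ?_⟩
  · simpa using h
  · rw [h2]
    have := D.step i
    rw [c2_adj_iff] at this ⊢
    simpa using this
  · simpa using D.mem i
  · refine D.finite.preimage (f := fun p => v + L.symm p) (fun p _ q _ h => ?_)
    simpa using h
  · intro p hp hpt q hq
    refine D.inside _ hp ?_ _ ((s1 _ _).2 hq)
    rw [← hr]; simpa using hpt
  · intro W hW p hp q hq
    have := D.outside (fun p => W (L (p - v))) (fun p q h hp hq => hW _ _ ((s1' _ _).2 h)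
      (by rwa [hr]) (by rwa [hr])) (v + L.symm p) hp (v + L.symm q) hq
    simpa using this
  · intro i hi w k l hk hl hp hq
    have hT : Turn t i := by
      intro h
      apply hi
      simp only [← map_sub, sub_sub_sub_cancel_right, h]
    have e1 : v + L.symm (L (t i - v) + k • w) = t i + k • L.symm w := by
      rw [map_add, map_nsmul, AddEquiv.symm_apply_apply]; abel
    have e2 : v + L.symm (L (t i - v) - l • w) = t i - l • L.symm w := by
      rw [map_sub, map_nsmul, AddEquiv.symm_apply_apply]; abel
    have := D.extreme i hT (L.symm w) k l hk hl (e1 ▸ hp) (e2 ▸ hq)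
    simpa using this

/-! ### Straight stretches -/

lemma exists_turn (D : Disk t X) (i : ZMod n) : ∃ K : ℕ, 1 ≤ K ∧ Turn t (i + K) ∧
    ∀ j : ℕ, j ≤ K → t (i + j) = t i + j • (t (i + 1) - t i) :=
  exists_turn_of_injective (by have := D.four_le; omega) D.inj i

lemma exists_turn_backward (D : Disk t X) (i : ZMod n) : ∃ K : ℕ, 1 ≤ K ∧ Turn t (i - K) ∧
    ∀ j : ℕ, j ≤ K → t (i - j) = t i + j • (t (i - 1) - t i) := by
  obtain ⟨K, h1, h2, h3⟩ := D.reverse.exists_turn (-i)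
  refine ⟨K, h1, ?_, fun j hj => ?_⟩
  · rw [turn_neg] at h2
    convert h2 using 1; ring
  · have := h3 j hj
    simp only [neg_add, neg_neg] at this
    simpa only [sub_eq_add_neg] using this

lemma exists_notMem_ray (D : Disk t X) (p w : Plane) (hw : w ≠ 0) : ∃ m : ℕ, p + m • w ∉ X := by
  by_contra! h
  refine Set.infinite_of_injective_forall_mem (f := fun m : ℕ => p + m • w) ?_ h D.finite
  intro a b hab
  by_contra hne
  refine hw (Prod.ext ?_ ?_)
  · have := congrArg Prod.fst hab
    simpa [hne] using this
  · have := congrArg Prod.snd hab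
    simpa [hne] using this

/-- A half-plane that contains the curve contains the disk. -/
lemma snd_nonneg (D : Disk t X) (h : ∀ k, 0 ≤ (t k).2) : ∀ p ∈ X, 0 ≤ p.2 := by
  intro p hp
  by_contra! hneg
  -- Below the axis there are no curve points, so a downward ray that starts in `X` could never
  -- leave it.
  obtain ⟨m, hm⟩ := D.exists_notMem_ray p (0, -1) (by simp)
  apply hm
  clear hm
  induction m with
  | zero => simpa using hp
  | succ m ih =>
    refine D.inside _ ih ?_ _ ?_
    · rintro ⟨k, hk⟩
      have := h k
      rw [hk] at this
      simp at this
      omega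
    · rw [c1_adj_iff]
      simp
      omega

end Disk

/-! ### Crossing numbers -/

/-- The signed crossing of the step from `p` to `p'` with the vertical half-line that starts just
to the right of `q` and goes up. -/
def crossing (q p p' : Plane) : ℤ :=
  (if p.1 = q.1 ∧ p'.1 = q.1 + 1 ∧ q.2 < p.2 then 1 else 0) -
    (if p'.1 = q.1 ∧ p.1 = q.1 + 1 ∧ q.2 < p'.2 then 1 else 0)

/-- The crossing number of a closed curve about the point `q`. -/
def crossingNumber {n : ℕ} [NeZero n] (t : ZMod n → Plane) (q : Plane) : ℤ :=
  ∑ i, crossing q (t i) (t (i + 1))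

lemma sum_shift_sub {n : ℕ} [NeZero n] (h : ZMod n → ℤ) : ∑ i, (h (i + 1) - h i) = 0 := by
  rw [Finset.sum_sub_distrib, sub_eq_zero]
  exact Equiv.sum_comp (Equiv.addRight (1 : ZMod n)) h

namespace Disk

variable {n : ℕ} {t : ZMod n → Plane} {X : Set Plane}

lemma neZero (D : Disk t X) : NeZero n := ⟨by have := D.four_le; omega⟩

lemma step_coords (D : Disk t X) (i : ZMod n) :
    ((t i).1 ≠ (t (i + 1)).1 ∨ (t i).2 ≠ (t (i + 1)).2) ∧ -1 ≤ (t i).1 - (t (i + 1)).1 ∧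
      (t i).1 - (t (i + 1)).1 ≤ 1 ∧ -1 ≤ (t i).2 - (t (i + 1)).2 ∧
      (t i).2 - (t (i + 1)).2 ≤ 1 := (c2_adj_iff _ _).1 (D.step i)

lemma ne_coords {q : Plane} (h : q ∉ Set.range t) (i : ZMod n) :
    (t i).1 ≠ q.1 ∨ (t i).2 ≠ q.2 := by
  by_contra! hc
  exact h ⟨i, Prod.ext hc.1 hc.2⟩

/-- The two half-lines differ only in crossings by steps that have `q'` as an endpoint, and `q'` is
off the curve. -/
lemma crossingNumber_up [NeZero n] {q q' : Plane}
    (hq' : q' ∉ Set.range t) (h1 : q'.1 = q.1) (h2 : q'.2 = q.2 + 1) :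
    crossingNumber t q = crossingNumber t q' := by
  refine Finset.sum_congr rfl fun i _ => ?_
  have := ne_coords hq' i
  have := ne_coords hq' (i + 1)
  simp only [crossing]
  split_ifs <;> omega

/-- Conservation of flow: the difference is the net flow into the part of the column of `q'` above
`q'`, which telescopes to zero around the closed curve. No step slips past at the lower end, since
neither `q` nor `q'` is on the curve. -/
lemma crossingNumber_right (D : Disk t X) [NeZero n] {q q' : Plane} (hq : q ∉ Set.range t)
    (hq' : q' ∉ Set.range t) (h1 : q'.1 = q.1 + 1) (h2 : q'.2 = q.2) :
    crossingNumber t q = crossingNumber t q' := by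
  rw [← sub_eq_zero, crossingNumber, crossingNumber, ← Finset.sum_sub_distrib,
    ← sum_shift_sub (fun i => if (t i).1 = q'.1 ∧ q.2 < (t i).2 then 1 else 0)]
  refine Finset.sum_congr rfl fun i _ => ?_
  have := ne_coords hq i
  have := ne_coords hq (i + 1)
  have := ne_coords hq' i
  have := ne_coords hq' (i + 1)
  have := D.step_coords i
  simp only [crossing]
  split_ifs <;> omega

/-- Connectedness of the exterior enters through `outside`, with `W` the crossing number. -/
lemma crossingNumber_eq (D : Disk t X) [NeZero n] {p q : Plane} (hp : p ∉ X) (hq : q ∉ X) :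
    crossingNumber t p = crossingNumber t q := by
  refine D.outside _ (fun p q h hp hq => ?_) p hp q hq
  rw [c1_adj_iff] at h
  rcases h with ⟨h1, h2⟩ | ⟨h1, h2⟩ | ⟨h1, h2⟩ | ⟨h1, h2⟩
  · exact D.crossingNumber_right hp hq h1 h2
  · exact (D.crossingNumber_right hq hp (by omega) h2.symm).symm
  · exact crossingNumber_up hq h1 h2
  · exact (crossingNumber_up hp h1.symm (by omega)).symm

lemma notMem_range (D : Disk t X) {p : Plane} (h : p ∉ X) : p ∉ Set.range t := by
  rintro ⟨i, rfl⟩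
  exact h (D.mem i)

/-- The step separates `(0, 1)` from `(1, 0)`: were both outside, their crossing numbers would
agree, yet they differ by this one step, which the curve never retraces. -/
lemma slanted_step_aux (D : Disk t X) {i : ZMod n} (h0 : t i = (0, 0)) (h1 : t (i + 1) = (1, 1)) :
    ((1, 0) : Plane) ∈ X ∨ ((0, 1) : Plane) ∈ X := by
  by_contra! hc
  have := D.neZero
  have e := D.crossingNumber_eq hc.2 hc.1
  have hi2 : t (i + 1 + 1) ≠ (0, 0) := by
    rw [← h0]
    intro h
    have := D.inj h
    rw [add_assoc, add_eq_left] at this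
    exact D.natCast_ne_zero (m := 2) two_pos (by norm_num) (by push_cast; rw [← this]; norm_num)
  have s1 : ∑ k, (if t k = (0, 0) ∧ t (k + 1) = (1, 1) then (1 : ℤ) else 0) = 1 := by
    rw [Finset.sum_eq_single i]
    · simp [h0, h1]
    · intro k _ hk
      rw [if_neg]
      rintro ⟨h, -⟩
      exact hk (D.inj (h.trans h0.symm))
    · simp
  have s2 : ∑ k, (if t k = (1, 1) ∧ t (k + 1) = (0, 0) then (1 : ℤ) else 0) = 0 := by
    refine Finset.sum_eq_zero fun k _ => ?_
    rw [if_neg]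
    rintro ⟨h, h'⟩
    rw [D.inj (h.trans h1.symm)] at h'
    exact hi2 h'
  have s3 := sum_shift_sub (fun k => if (t k).1 = 1 ∧ 0 < (t k).2 then 1 else 0)
  rw [← sub_eq_zero, crossingNumber, crossingNumber, ← Finset.sum_sub_distrib] at e
  -- Flow into the half-column `x = 1`, `y > 0`: the only steps from column 0 that enter or leave it
  -- without being counted by `crossing (0, 1)` join `(0, 0)` and `(1, 1)`.
  have : ∀ k : ZMod n, crossing (0, 1) (t k) (t (k + 1)) - crossing (1, 0) (t k) (t (k + 1)) =
      (((if (t (k + 1)).1 = 1 ∧ 0 < (t (k + 1)).2 then 1 else 0) -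
        (if (t k).1 = 1 ∧ 0 < (t k).2 then 1 else 0)) -
      (if t k = (0, 0) ∧ t (k + 1) = (1, 1) then (1 : ℤ) else 0)) +
      (if t k = (1, 1) ∧ t (k + 1) = (0, 0) then (1 : ℤ) else 0) := by
    intro k
    have := ne_coords (D.notMem_range hc.1) k
    have := ne_coords (D.notMem_range hc.1) (k + 1)
    have := ne_coords (D.notMem_range hc.2) k
    have := ne_coords (D.notMem_range hc.2) (k + 1)
    have := D.step_coords k
    simp only [crossing, Prod.ext_iff] at *
    split_ifs <;> omega
  simp only [this, Finset.sum_add_distrib] at e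
  rw [Finset.sum_sub_distrib, s1, s2, s3] at e
  norm_num at e

/-- Both `(1, -1)` and `(1, 1)` are outside, and their crossing numbers differ by the steps between
`(1, 0)` and column 2. The curve enters `(1, 0)` from `(0, 0)`, so it cannot leave to column 2, and
only `(0, 1)` remains. -/
lemma corner_aux (D : Disk t X) {i : ZMod n} (h0 : t i = (0, 0)) (h1 : t (i + 1) = (1, 0))
    (hX : ∀ p ∈ X, 0 ≤ p.2) (hc : ((1, 1) : Plane) ∉ X) : t (i + 2) = (0, 1) := by
  have := D.neZero
  have hc' : ((1, -1) : Plane) ∉ X := fun h => by simpa using hX _ h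
  have e := D.crossingNumber_eq hc' hc
  have hi2 : i + 1 + 1 = i + 2 := by rw [add_assoc]; norm_num
  have s1 : ∑ k, (if t k = (1, 0) ∧ (t (k + 1)).1 = 2 then (1 : ℤ) else 0) =
      if (t (i + 2)).1 = 2 then 1 else 0 := by
    rw [Finset.sum_eq_single (i + 1)]
    · simp [h1, hi2]
    · intro k _ hk
      rw [if_neg]
      rintro ⟨h, -⟩
      exact hk (D.inj (h.trans h1.symm))
    · simp
  have s2 : ∑ k, (if t (k + 1) = (1, 0) ∧ (t k).1 = 2 then (1 : ℤ) else 0) = 0 := by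
    refine Finset.sum_eq_zero fun k _ => ?_
    rw [if_neg]
    rintro ⟨h, h'⟩
    have := add_right_cancel (D.inj (h.trans h1.symm))
    rw [this, h0] at h'
    norm_num at h'
  rw [← sub_eq_zero, crossingNumber, crossingNumber, ← Finset.sum_sub_distrib] at e
  have : ∀ k : ZMod n, crossing (1, -1) (t k) (t (k + 1)) - crossing (1, 1) (t k) (t (k + 1)) =
      (if t k = (1, 0) ∧ (t (k + 1)).1 = 2 then (1 : ℤ) else 0) -
      (if t (k + 1) = (1, 0) ∧ (t k).1 = 2 then (1 : ℤ) else 0) := by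
    intro k
    have := ne_coords (D.notMem_range hc) k
    have := ne_coords (D.notMem_range hc) (k + 1)
    have := hX _ (D.mem k)
    have := hX _ (D.mem (k + 1))
    simp only [crossing, Prod.ext_iff] at *
    split_ifs <;> omega
  simp only [this, Finset.sum_sub_distrib] at e
  rw [s1, s2] at e
  have h2 : (t (i + 2)).1 ≠ 2 := by
    intro h
    simp [h] at e
  have h3 := D.step_coords (i + 1)
  have h4 := ne_coords (D.notMem_range hc) (i + 2)
  have h5 := hX _ (D.mem (i + 2))
  have h6 : t (i + 2) ≠ (0, 0) := by
    rw [← h0]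
    intro h
    have := D.inj h
    rw [add_eq_left] at this
    exact D.natCast_ne_zero (m := 2) two_pos (by norm_num) (by push_cast; exact this)
  rw [hi2, h1] at h3
  simp only [ne_eq, Prod.ext_iff] at *
  omega

/-- A side of the curve in the positive `x`-direction leaves the curve on one side. -/
lemma axis_aux (D : Disk t X) {i : ZMod n} (hT : Turn t i) (h0 : t i = (0, 0))
    (h1 : t (i + 1) = (1, 0)) : (∀ k, 0 ≤ (t k).2) ∨ (∀ k, (t k).2 ≤ 0) := by
  have := D.neZero
  obtain ⟨K, hK, hTK, hK'⟩ := D.exists_turn i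
  have hj : ∀ j : ℕ, j ≤ K → t (i + j) = ((j : ℤ), 0) := by
    intro j hj
    rw [hK' j hj, h0, h1]
    simp
  -- the points of the curve on the axis are those of the side
  have haxis : ∀ m : ℕ, K < m → m < n → (t (i + m)).2 ≠ 0 := by
    intro m hm hmn h
    obtain ⟨x, hx⟩ : ∃ x, t (i + m) = (x, 0) := ⟨_, Prod.ext rfl h⟩
    have hxX : ((x, 0) : Plane) ∈ X := hx ▸ D.mem _
    have h10 : ((1, 0) : Plane) ∈ X := h1 ▸ D.mem _
    -- Beyond either end of the side, such a point would put a turning point strictly between two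
    -- points of `X`; within the side, it would be visited twice.
    by_cases hx0 : x < 0
    · have := D.extreme i hT (1, 0) 1 (-x).toNat one_pos (by omega)
        (by rw [h0]; simpa using h10) (by
          rw [h0]
          have e : (((0, 0) : Plane) - (-x).toNat • ((1, 0) : Plane)) = (x, 0) := by
            ext <;> simp
            omega
          rwa [e])
      simp at this
    by_cases hxK : (K : ℤ) < x
    · have := D.extreme _ hTK (1, 0) (x - K).toNat K (by omega) (by omega)
        (by
          rw [hj K le_rfl]
          have e : (((K : ℤ), 0) : Plane) + (x - K).toNat • ((1, 0) : Plane) = (x, 0) := by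
            ext <;> simp
            omega
          rwa [e])
        (by
          rw [hj K le_rfl]
          have e : (((K : ℤ), 0) : Plane) - K • ((1, 0) : Plane) = (0, 0) := by
            ext <;> simp
          rw [e, ← h0]
          exact D.mem _)
      simp at this
    have e := hj x.toNat (by omega)
    rw [show ((x.toNat : ℕ) : ℤ) = x by omega, ← hx] at e
    have e := congrArg ZMod.val (add_left_cancel (D.inj e))
    rw [ZMod.val_cast_of_lt (by omega), ZMod.val_cast_of_lt hmn] at e
    omega
  -- Heights change by at most one per step, so off the axis the sign persists.
  have hsign : ∀ m : ℕ, K < m → m < n →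
      (0 < (t (i + m)).2 ↔ 0 < (t (i + (K + 1 : ℕ))).2) := by
    intro m hm
    induction m, hm using Nat.le_induction with
    | base => simp
    | succ m hm ih =>
      intro hmn
      rw [← ih (by omega)]
      have e : i + ((m + 1 : ℕ) : ZMod n) = i + m + 1 := by push_cast; ring
      have h2 := haxis m hm (by omega)
      have h3 := haxis (m + 1) (by omega) hmn
      have h4 := D.step_coords (i + m)
      rw [e] at h3 ⊢
      omega
  have hall : ∀ k : ZMod n, ∃ m : ℕ, m < n ∧ k = i + m := fun k =>
    ⟨(k - i).val, ZMod.val_lt _, by simp⟩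
  by_cases hs : 0 < (t (i + (K + 1 : ℕ))).2
  · left
    intro k
    obtain ⟨m, hm, rfl⟩ := hall k
    by_cases hmK : m ≤ K
    · rw [hj m hmK]
    · exact ((hsign m (by omega) hm).2 hs).le
  · right
    intro k
    obtain ⟨m, hm, rfl⟩ := hall k
    by_cases hmK : m ≤ K
    · rw [hj m hmK]
    · have := hsign m (by omega) hm
      omega

end Disk

/-! ### Turning points -/

/-- The map that moves `v` to a point at distance at least two, and fixes all other points of `X`,
is continuous for a suitable choice of the image. -/
def Pushable (X : Set Plane) (v : Plane) : Prop :=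
  ∃ q ∈ X, q ≠ v ∧ ¬ c1.Adj v q ∧ ∀ w ∈ X, c1.Adj v w → c1.Adj w q

/-- `t i` has a neighbour `w` that can be pushed away and has no other neighbour than `t i`. -/
def Cusp {n : ℕ} (t : ZMod n → Plane) (X : Set Plane) (i : ZMod n) : Prop :=
  ∃ w ∈ Set.range t, c1.Adj (t i) w ∧ Pushable X w ∧ (∀ x ∈ X, c1.Adj w x → x = t i) ∧
    ∃ j, Turn t j ∧ t j ≠ t i ∧ t j ≠ w

lemma Cusp.of_reverse {n : ℕ} {t : ZMod n → Plane} {X : Set Plane} {i : ZMod n}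
    (h : Cusp (fun k => t (-k)) X (-i)) : Cusp t X i := by
  obtain ⟨w, ⟨k, rfl⟩, h1, h2, h3, j, h4, h5, h6⟩ := h
  simp only [neg_neg] at h1 h3 h5
  exact ⟨_, ⟨_, rfl⟩, h1, h2, h3, -j, turn_neg.1 h4, h5, h6⟩

/-! ### Symmetries of the digital plane. -/

/-- Two perpendicular unit vectors. -/
def IsFrame (a b : Plane) : Prop :=
  ((a = (1, 0) ∨ a = (-1, 0)) ∧ (b = (0, 1) ∨ b = (0, -1))) ∨
    ((a = (0, 1) ∨ a = (0, -1)) ∧ (b = (1, 0) ∨ b = (-1, 0)))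

instance (a b : Plane) : Decidable (IsFrame a b) := by unfold IsFrame; infer_instance

/-- The linear symmetry of the plane with matrix rows `a` and `b`. -/
def IsFrame.equiv {a b : Plane} (h : IsFrame a b) : Plane ≃+ Plane where
  toFun p := (a.1 * p.1 + a.2 * p.2, b.1 * p.1 + b.2 * p.2)
  invFun p := (p.1 * a.1 + p.2 * b.1, p.1 * a.2 + p.2 * b.2)
  left_inv p := by
    rcases h with ⟨rfl | rfl, rfl | rfl⟩ | ⟨rfl | rfl, rfl | rfl⟩ <;> simp
  right_inv p := by
    rcases h with ⟨rfl | rfl, rfl | rfl⟩ | ⟨rfl | rfl, rfl | rfl⟩ <;> simp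
  map_add' p q := by ext <;> simp <;> ring

section Symmetry

variable {a b : Plane} (h : IsFrame a b)

lemma IsFrame.equiv_fst : h.equiv a = (1, 0) := by
  rcases h with ⟨rfl | rfl, rfl | rfl⟩ | ⟨rfl | rfl, rfl | rfl⟩ <;> rfl

lemma IsFrame.equiv_snd : h.equiv b = (0, 1) := by
  rcases h with ⟨rfl | rfl, rfl | rfl⟩ | ⟨rfl | rfl, rfl | rfl⟩ <;> rfl

lemma IsFrame.c1_adj (p q : Plane) : c1.Adj (h.equiv p) (h.equiv q) ↔ c1.Adj p q := by
  simp only [c1_adj_iff, equiv, AddEquiv.coe_mk, Equiv.coe_fn_mk]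
  rcases h with ⟨rfl | rfl, rfl | rfl⟩ | ⟨rfl | rfl, rfl | rfl⟩ <;> simp only <;> omega

lemma IsFrame.c2_adj (p q : Plane) : c2.Adj (h.equiv p) (h.equiv q) ↔ c2.Adj p q := by
  simp only [c2_adj_iff, equiv, AddEquiv.coe_mk, Equiv.coe_fn_mk]
  rcases h with ⟨rfl | rfl, rfl | rfl⟩ | ⟨rfl | rfl, rfl | rfl⟩ <;> simp only <;> omega

lemma IsFrame.c1_adj_sub (v p q : Plane) :
    c1.Adj (h.equiv (p - v)) (h.equiv (q - v)) ↔ c1.Adj p q := by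
  rw [h.c1_adj]
  simp only [c1_adj_iff, Prod.fst_sub, Prod.snd_sub]
  omega

lemma Pushable.of_transport {X : Set Plane} {v u : Plane}
    (hP : Pushable {p | v + h.equiv.symm p ∈ X} (h.equiv (u - v))) : Pushable X u := by
  obtain ⟨q, hq, h1, h2, h3⟩ := hP
  have e : q = h.equiv ((v + h.equiv.symm q) - v) := by simp
  rw [e] at h1 h2 h3
  rw [h.c1_adj_sub] at h2
  refine ⟨_, hq, fun e' => h1 (by rw [e']), h2, fun w hw hvw => ?_⟩
  have := h3 (h.equiv (w - v)) (by simpa using hw) ((h.c1_adj_sub _ _ _).2 hvw)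
  rwa [h.c1_adj_sub] at this

lemma Cusp.of_transport {n : ℕ} {t : ZMod n → Plane} {X : Set Plane} {v : Plane} {i : ZMod n}
    (hC : Cusp (fun i => h.equiv (t i - v)) {p | v + h.equiv.symm p ∈ X} i) : Cusp t X i := by
  obtain ⟨w, ⟨k, rfl⟩, h1, h2, h3, j, h4, h5, h6⟩ := hC
  refine ⟨_, ⟨k, rfl⟩, (h.c1_adj_sub _ _ _).1 h1, h2.of_transport h, fun x hx hw => ?_, j, ?_,
    fun e => h5 (by simp only [e]), fun e => h6 (by simp only [e])⟩
  · have := h3 (h.equiv (x - v)) (by simpa using hx) ((h.c1_adj_sub _ _ _).2 hw)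
    simpa using this
  · intro e
    apply h4
    simp only [← map_sub, sub_sub_sub_cancel_right, e]

end Symmetry

/-- The eight directions of a `c₂`-step. -/
def directions : Finset Plane :=
  {(1, 0), (-1, 0), (0, 1), (0, -1), (1, 1), (1, -1), (-1, 1), (-1, -1)}

/-- The four directions of a `c₁`-step. -/
def unitVectors : Finset Plane := {(1, 0), (-1, 0), (0, 1), (0, -1)}

lemma mem_directions {p q : Plane} (h : c2.Adj p q) : q - p ∈ directions := by
  rw [c2_adj_iff] at h
  simp only [directions, Finset.mem_insert, Finset.mem_singleton, Prod.ext_iff, Prod.fst_sub,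
    Prod.snd_sub]
  omega

-- Up to symmetry and reversal of the curve, a corner has an axis-parallel side along `a` and a
-- second side along `b`, `a + b` or `b - a`, or it has two perpendicular slanted sides.
set_option maxRecDepth 10000 in
lemma exists_frame_of_directions : ∀ d ∈ directions, ∀ d' ∈ directions, d ≠ d' → d ≠ -d' →
    ∃ a ∈ unitVectors, ∃ b ∈ unitVectors, IsFrame a b ∧
      ((d = a ∧ (d' = b ∨ d' = a + b ∨ d' = b - a)) ∨
        (d' = a ∧ (d = b ∨ d = a + b ∨ d = b - a)) ∨ (d = a + b ∧ d' = b - a)) := by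
  decide

namespace Disk

variable {n : ℕ} {t : ZMod n → Plane} {X : Set Plane}

/-- Of the two points that complete a slanted step to a unit square, one belongs to the disk. -/
lemma slanted_step (D : Disk t X) (i : ZMod n) (h1 : (t i).1 ≠ (t (i + 1)).1)
    (h2 : (t i).2 ≠ (t (i + 1)).2) :
    (((t i).1, (t (i + 1)).2) : Plane) ∈ X ∨ (((t (i + 1)).1, (t i).2) : Plane) ∈ X := by
  have h3 := D.step_coords i
  have hf : IsFrame ((t (i + 1)).1 - (t i).1, 0) (0, (t (i + 1)).2 - (t i).2) := by
    left
    simp only [Prod.mk.injEq, and_true, true_and]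
    omega
  have := (D.transport hf.equiv hf.c1_adj hf.c2_adj (t i)).slanted_step_aux (i := i)
    (by rw [sub_self, map_zero]; rfl)
    (by
      have e : t (i + 1) - t i =
        ((t (i + 1)).1 - (t i).1, 0) + (0, (t (i + 1)).2 - (t i).2) := by ext <;> simp
      rw [e, map_add, hf.equiv_fst, hf.equiv_snd]; rfl)
  rw [← hf.equiv_fst, ← hf.equiv_snd] at this
  simp only [Set.mem_ofPred_eq, AddEquiv.symm_apply_apply] at this
  rw [or_comm]
  convert this using 2 <;> ext <;> simp

/-- The supporting line of the side and extremeness leave only `(1, 0)` and `(0, 1)` as possible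
neighbours of the origin. If `(1, 1)` is in `X`, it is adjacent to both. Otherwise the curve doubles
back to `(0, 1)`, and `(1, 0)` is a pendant point that can be pushed there. -/
lemma axis_vertex_aux (D : Disk t X) {i : ZMod n} (hT : Turn t i) (h0 : t i = (0, 0))
    (h1 : t (i + 1) = (1, 0)) (h2 : t (i - 1) = (0, 1) ∨ t (i - 1) = (1, 1) ∨ t (i - 1) = (-1, 1)) :
    Pushable X (t i) ∨ Cusp t X i := by
  have hX : ∀ p ∈ X, 0 ≤ p.2 := by
    refine D.snd_nonneg ((D.axis_aux hT h0 h1).resolve_right fun h => ?_)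
    have := h (i - 1)
    rcases h2 with h2 | h2 | h2 <;> rw [h2] at this <;> norm_num at this
  have h10 : ((1, 0) : Plane) ∈ X := h1 ▸ D.mem _
  have h00 : ((0, 0) : Plane) ∈ X := h0 ▸ D.mem _
  have hl : ((-1, 0) : Plane) ∉ X := by
    intro h
    have := D.extreme i hT (1, 0) 1 1 one_pos one_pos (by rw [h0]; simpa using h10)
      (by rw [h0]; simpa using h)
    simp at this
  by_cases hc : ((1, 1) : Plane) ∈ X
  · left
    rw [h0]
    refine ⟨_, hc, by simp, by simp [c1_adj_iff], ?_⟩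
    rintro ⟨x, y⟩ hw hadj
    have h3 := hX _ hw
    rw [c1_adj_iff] at hadj ⊢
    have h4 : ¬ (x = -1 ∧ y = 0) := by
      rintro ⟨rfl, rfl⟩
      exact hl hw
    simp only at *
    omega
  right
  have h3 := D.corner_aux h0 h1 hX hc
  have h4 : t (i - 1) ≠ (0, 1) := by
    intro h
    have := D.inj (h3.trans h.symm)
    refine D.natCast_ne_zero (m := 3) (by norm_num) le_rfl ?_
    have : (i + 2) - (i - 1) = 0 := sub_eq_zero.2 this
    push_cast
    rw [← this]; ring
  have h5 : t (i - 1) ≠ (1, 1) := fun h => hc (h ▸ D.mem _)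
  have e2 : i + 1 + 1 = i + 2 := by rw [add_assoc]; norm_num
  have hT1 : Turn t (i + 1) := by
    rw [Turn, e2, add_sub_cancel_right, h0, h1, h3]
    simp
  have hr : ((2, 0) : Plane) ∉ X := by
    intro h
    have := D.extreme (i + 1) hT1 (1, 0) 1 1 one_pos one_pos (by rw [h1]; simpa using h)
      (by rw [h1]; simpa [← Prod.mk_zero_zero] using h00)
    simp at this
  have hw : ∀ x ∈ X, c1.Adj (1, 0) x → x = (0, 0) := by
    rintro ⟨x, y⟩ hx hadj
    have h3 := hX _ hx
    have h4 : ¬ (x = 2 ∧ y = 0) := by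
      rintro ⟨rfl, rfl⟩
      exact hr hx
    have h5 : ¬ (x = 1 ∧ y = 1) := by
      rintro ⟨rfl, rfl⟩
      exact hc hx
    rw [c1_adj_iff] at hadj
    simp only [Prod.mk.injEq] at *
    omega
  -- The far end of the slanted stretch through `(1, 0)` and `(0, 1)` serves as the further turning
  -- point that `Cusp` requires.
  obtain ⟨K, hK, hTK, hK'⟩ := D.exists_turn (i + 1)
  have e := hK' K le_rfl
  rw [e2, h1, h3] at e
  refine ⟨(1, 0), ⟨_, h1⟩, by simp [h0, c1_adj_iff], ⟨(0, 1), h3 ▸ D.mem _, by simp,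
    by simp [c1_adj_iff], fun w hw' hadj => ?_⟩, by rwa [h0], i + 1 + K, hTK, ?_, ?_⟩
  · rw [hw w hw' hadj]
    simp [c1_adj_iff]
  · rw [e, h0]
    simp
    omega
  · rw [e]
    simp
    omega

/-- Extremeness forbids opposite neighbours, so the two slanted steps can only be completed if `(0,
1)` is in `X`. At most one horizontal neighbour remains; the origin is pushed to `(-1, 1)` if that
is the left one, to `(1, 1)` otherwise. -/
lemma slanted_vertex_aux (D : Disk t X) {i : ZMod n} (hT : Turn t i) (h0 : t i = (0, 0))
    (h1 : t (i + 1) = (1, 1)) (h2 : t (i - 1) = (-1, 1)) : Pushable X (t i) := by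
  have hne : ∀ w : Plane, w ≠ 0 → w ∈ X → -w ∉ X := by
    intro w hw h h'
    exact hw (D.extreme i hT w 1 1 one_pos one_pos (by rw [h0, Prod.mk_zero_zero]; simpa using h)
      (by rw [h0, Prod.mk_zero_zero]; simpa using h'))
  have s1 := D.slanted_step i (by simp [h0, h1]) (by simp [h0, h1])
  have s2 := D.slanted_step (i - 1) (by simp [h0, h2]) (by simp [h0, h2])
  rw [sub_add_cancel] at s2
  simp only [h0, h1, h2] at s1 s2
  have h11 : ((1, 1) : Plane) ∈ X := h1 ▸ D.mem _
  have h11' : ((-1, 1) : Plane) ∈ X := h2 ▸ D.mem _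
  have hlr : ((1, 0) : Plane) ∈ X → ((-1, 0) : Plane) ∉ X := fun h => by
    simpa using hne (1, 0) (by simp) h
  have hu : ((0, 1) : Plane) ∈ X := by tauto
  have hd : ((0, -1) : Plane) ∉ X := by simpa using hne _ (by simp) hu
  rw [h0]
  by_cases hl : ((-1, 0) : Plane) ∈ X
  · refine ⟨_, h11', by simp, by simp [c1_adj_iff], ?_⟩
    rintro ⟨x, y⟩ hw hadj
    have h4 : ¬ (x = 1 ∧ y = 0) := by
      rintro ⟨rfl, rfl⟩
      exact hlr hw hl
    have h5 : ¬ (x = 0 ∧ y = -1) := by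
      rintro ⟨rfl, rfl⟩
      exact hd hw
    rw [c1_adj_iff] at hadj ⊢
    simp only at *
    omega
  · refine ⟨_, h11, by simp, by simp [c1_adj_iff], ?_⟩
    rintro ⟨x, y⟩ hw hadj
    have h4 : ¬ (x = -1 ∧ y = 0) := by
      rintro ⟨rfl, rfl⟩
      exact hl hw
    have h5 : ¬ (x = 0 ∧ y = -1) := by
      rintro ⟨rfl, rfl⟩
      exact hd hw
    rw [c1_adj_iff] at hadj ⊢
    simp only at *
    omega

lemma axis_vertex (D : Disk t X) {i : ZMod n} (hT : Turn t i) {a b : Plane} (hf : IsFrame a b)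
    (h1 : t (i + 1) - t i = a) (h2 : t (i - 1) - t i = b ∨ t (i - 1) - t i = a + b ∨
      t (i - 1) - t i = b - a) : Pushable X (t i) ∨ Cusp t X i := by
  have := (D.transport hf.equiv hf.c1_adj hf.c2_adj (t i)).axis_vertex_aux (i := i) (fun e => hT ?_)
    (by rw [sub_self, map_zero]; rfl) (by rw [h1, hf.equiv_fst]) ?_
  · exact this.imp (Pushable.of_transport hf) (Cusp.of_transport hf)
  · simpa only [← map_sub, sub_sub_sub_cancel_right, hf.equiv.injective.eq_iff] using e
  · rcases h2 with h2 | h2 | h2 <;> rw [h2]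
    · left; rw [hf.equiv_snd]
    · right; left; rw [map_add, hf.equiv_fst, hf.equiv_snd]; rfl
    · right; right; rw [map_sub, hf.equiv_fst, hf.equiv_snd]; rfl

lemma pushable_or_cusp (D : Disk t X) {i : ZMod n} (hT : Turn t i) :
    Pushable X (t i) ∨ Cusp t X i := by
  have m1 := mem_directions (D.step i)
  have m2 := mem_directions (D.step (i - 1)).symm
  rw [sub_add_cancel] at m2
  have n1 : t (i + 1) - t i ≠ t (i - 1) - t i := by
    intro h
    have := sub_eq_zero.2 (D.inj (sub_left_inj.1 h))
    refine D.natCast_ne_zero (m := 2) (by norm_num) (by norm_num) ?_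
    push_cast
    rw [← this]; ring
  have n2 : t (i + 1) - t i ≠ -(t (i - 1) - t i) := by
    rw [neg_sub]; exact hT
  obtain ⟨a, -, b, -, hf, ⟨h1, h2⟩ | ⟨h1, h2⟩ | ⟨h1, h2⟩⟩ :=
    exists_frame_of_directions _ m1 _ m2 n1 n2
  · exact D.axis_vertex hT hf h1 h2
  · have := D.reverse.axis_vertex (i := -i) (by rw [turn_neg, neg_neg]; exact hT) hf
      (by rw [← h1, neg_add', neg_neg]) (by
        rwa [neg_sub, sub_neg_eq_add, neg_neg, add_comm 1 i])
    rw [neg_neg] at this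
    exact this.imp id Cusp.of_reverse
  · left
    refine Pushable.of_transport hf (v := t i)
      ((D.transport hf.equiv hf.c1_adj hf.c2_adj (t i)).slanted_vertex_aux (i := i)
        (fun e => hT ?_) (by rw [sub_self, map_zero]; rfl) ?_ ?_)
    · simpa only [← map_sub, sub_sub_sub_cancel_right, hf.equiv.injective.eq_iff] using e
    · rw [h1, map_add, hf.equiv_fst, hf.equiv_snd]; rfl
    · rw [h2, map_sub, hf.equiv_fst, hf.equiv_snd]; rfl

end Disk

/-! ### Rigidity of maps that move points by at most one -/

lemma dist1_eq_one {p q : Plane} (h : c1.Adj p q) : dist1 p q = 1 := h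

/-- Every unit move from `p` increases the `ℓ¹` distance to one of the two ends. For slanted `d` the
bound `h` is essential: a diagonal move perpendicular to `d` can preserve both distances. -/
lemma eq_of_dist1_opposite {p q d : Plane} {K M : ℕ} (hd : d ∈ directions) (h : dist1 p q ≤ 1)
    (hK : dist1 q (p + K • d) ≤ K * dist1 0 d) (hM : dist1 q (p + M • -d) ≤ M * dist1 0 d) :
    q = p := by
  obtain ⟨p1, p2⟩ := p
  obtain ⟨q1, q2⟩ := q
  simp only [directions, Finset.mem_insert, Finset.mem_singleton] at hd
  rw [dist1_le_one_iff, c1_adj_iff] at h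
  simp only [dist1, Prod.mk.injEq] at *
  rcases hd with rfl | rfl | rfl | rfl | rfl | rfl | rfl | rfl <;>
  simp at hK hM <;>
  grind

namespace Disk

variable {n : ℕ} {t : ZMod n → Plane} {X : Set Plane}

/-- The `i`-th point of the curve as a point of the disk. -/
def vertex (D : Disk t X) (i : ZMod n) : X := ⟨t i, D.mem i⟩

/-- Consecutive points of the curve are joined in the disk by one or two unit steps. -/
lemma adj_or_exists_mid (D : Disk t X) (i : ZMod n) :
    c1.Adj (t i) (t (i + 1)) ∨ (dist1 (t i) (t (i + 1)) = 2 ∧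
      ∃ m ∈ X, c1.Adj (t i) m ∧ c1.Adj m (t (i + 1))) := by
  have h := D.step_coords i
  by_cases h1 : (t i).1 = (t (i + 1)).1
  · left; rw [c1_adj_iff]; omega
  by_cases h2 : (t i).2 = (t (i + 1)).2
  · left; rw [c1_adj_iff]; omega
  right
  refine ⟨?_, ?_⟩
  · simp only [dist1]
    rcases abs_cases ((t i).1 - (t (i + 1)).1) with ⟨e, _⟩ | ⟨e, _⟩ <;>
    rcases abs_cases ((t i).2 - (t (i + 1)).2) with ⟨e', _⟩ | ⟨e', _⟩ <;> rw [e, e'] <;> omega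
  · rcases D.slanted_step i h1 h2 with hm | hm
    · refine ⟨_, hm, ?_, ?_⟩ <;> rw [c1_adj_iff] <;> dsimp only <;> omega
    · refine ⟨_, hm, ?_, ?_⟩ <;> rw [c1_adj_iff] <;> dsimp only <;> omega

lemma reachable_succ (D : Disk t X) (i : ZMod n) :
    (c1.induce X).Reachable (D.vertex i) (D.vertex (i + 1)) := by
  rcases D.adj_or_exists_mid i with h | ⟨-, m, hm, h1, h2⟩
  · exact SimpleGraph.Adj.reachable (G := c1.induce X) (u := D.vertex i) (v := D.vertex (i + 1)) h
  · exact (SimpleGraph.Adj.reachable (G := c1.induce X) (u := D.vertex i) (v := ⟨m, hm⟩) h1).trans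
      (SimpleGraph.Adj.reachable (G := c1.induce X) (u := ⟨m, hm⟩) (v := D.vertex (i + 1)) h2)

lemma reachable (D : Disk t X) (i j : ZMod n) :
    (c1.induce X).Reachable (D.vertex i) (D.vertex j) := by
  have := D.neZero
  have key : ∀ m : ℕ, (c1.induce X).Reachable (D.vertex i) (D.vertex (i + m)) := by
    intro m
    induction m with
    | zero => simp
    | succ m ih =>
      have := ih.trans (D.reachable_succ (i + m))
      rw [add_assoc] at this
      push_cast
      exact this
  have := key (j - i).val
  simpa using this

variable {f : X → X}

lemma dist1_step (D : Disk t X)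
    (hf : ∀ x y : X, c1.Adj x.1 y.1 → dist1 (f x) (f y) ≤ 1) (i : ZMod n) :
    dist1 (f (D.vertex i)) (f (D.vertex (i + 1))) ≤ dist1 (t i) (t (i + 1)) := by
  rcases D.adj_or_exists_mid i with h | ⟨h, m, hm, h1, h2⟩
  · exact (hf _ _ h).trans (dist1_eq_one h).ge
  · have := hf (D.vertex i) ⟨m, hm⟩ h1
    have := hf ⟨m, hm⟩ (D.vertex (i + 1)) h2
    have := dist1_triangle (f (D.vertex i)) (f ⟨m, hm⟩) (f (D.vertex (i + 1)))
    omega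

lemma dist1_straight (D : Disk t X)
    (hf : ∀ x y : X, c1.Adj x.1 y.1 → dist1 (f x) (f y) ≤ 1) (i : ZMod n) (K : ℕ)
    (hK : ∀ j : ℕ, j ≤ K → t (i + j) = t i + j • (t (i + 1) - t i)) :
    dist1 (f (D.vertex i)) (f (D.vertex (i + K))) ≤ K * dist1 0 (t (i + 1) - t i) := by
  induction K with
  | zero => simp [dist1]
  | succ K ih =>
    have h1 := ih (fun j hj => hK j (by omega))
    have h2 := D.dist1_step hf (i + K)
    have e : i + ((K + 1 : ℕ) : ZMod n) = i + K + 1 := by push_cast; ring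
    have h3 : dist1 (t (i + K)) (t (i + K + 1)) = dist1 0 (t (i + 1) - t i) := by
      rw [← e, hK K (by omega), hK (K + 1) le_rfl]
      simp only [dist1, add_smul, one_smul, Prod.fst_add, Prod.snd_add, Prod.fst_zero,
        Prod.snd_zero]
      congr 2 <;> ring
    have h4 := dist1_triangle (f (D.vertex i)) (f (D.vertex (i + K))) (f (D.vertex (i + K + 1)))
    rw [e]
    push_cast
    linarith

lemma exists_walk_map (hf : ∀ x y : X, c1.Adj x.1 y.1 → dist1 (f x) (f y) ≤ 1) {x y : X}
    (p : (c1.induce X).Walk x y) :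
    ∃ p' : (c1.induce X).Walk (f x) (f y), p'.length ≤ p.length := by
  induction p with
  | nil => exact ⟨.nil, le_rfl⟩
  | cons h p ih =>
    obtain ⟨p', hp'⟩ := ih
    rcases (dist1_le_one_iff _ _).1 (hf _ _ h) with e | e
    · rw [← Subtype.ext_iff] at e
      exact ⟨p'.copy e rfl, by simp; omega⟩
    · exact ⟨.cons (show (c1.induce X).Adj _ _ from e) p', by simpa using hp'⟩

lemma dist_map_le (hf : ∀ x y : X, c1.Adj x.1 y.1 → dist1 (f x) (f y) ≤ 1) {x y : X}
    (h : (c1.induce X).Reachable x y) :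
    (c1.induce X).dist (f x) (f y) ≤ (c1.induce X).dist x y := by
  obtain ⟨p, hp⟩ := h.exists_walk_length_eq_dist
  obtain ⟨p', hp'⟩ := exists_walk_map hf p
  exact (SimpleGraph.dist_le p').trans (hp'.trans hp.le)

/-- The image of `t i` lies within one of the fixed pendant point `t k`, whose only neighbour is `t
i`; so it is `t i` or `t k`. The latter is excluded because every path from `t k` to another fixed
point passes through `t i`, while `f` does not increase path distance. -/
lemma cusp_fixed (D : Disk t X) (hf : ∀ x y : X, c1.Adj x.1 y.1 → dist1 (f x) (f y) ≤ 1)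
    (hP : ∀ x : X, Pushable X x.1 → f x = x) {i : ZMod n} (hC : Cusp t X i) :
    f (D.vertex i) = D.vertex i := by
  obtain ⟨w, ⟨k, rfl⟩, hadj, hw, hN, j, hTj, hji, hjw⟩ := hC
  -- The further turning point `t j` is pushable or has a pushable pendant of its own. That pendant
  -- is not `t k`, whose only neighbour is `t i`.
  obtain ⟨l, hl, hlw⟩ : ∃ l, f (D.vertex l) = D.vertex l ∧ t l ≠ t k := by
    rcases D.pushable_or_cusp hTj with h | ⟨_, ⟨l, rfl⟩, hadj', hw', hN', -⟩
    · exact ⟨j, hP _ h, hjw⟩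
    · refine ⟨l, hP _ hw', fun e => hji ?_⟩
      rw [e] at hadj'
      exact hN _ (D.mem j) hadj'.symm
  have hfk : f (D.vertex k) = D.vertex k := hP _ hw
  have h1 := hf (D.vertex k) (D.vertex i) hadj.symm
  rw [hfk, dist1_le_one_iff] at h1
  rcases h1 with h1 | h1
  · exfalso
    have h1' : f (D.vertex i) = D.vertex k := Subtype.ext h1
    have h2 := dist_map_le hf (D.reachable i l)
    rw [h1', hl] at h2
    obtain ⟨q, hq⟩ := (D.reachable k l).exists_walk_length_eq_dist
    generalize hz : D.vertex l = z at *
    cases q with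
    | nil => exact hlw (congrArg Subtype.val hz)
    | @cons _ y _ h q =>
      have : y = D.vertex i := Subtype.ext (hN _ y.2 h)
      subst this
      have := SimpleGraph.dist_le q
      rw [SimpleGraph.Walk.length_cons] at hq
      omega
  · exact Subtype.ext (hN _ (f _).2 h1)

lemma turn_fixed (D : Disk t X) (hf : ∀ x y : X, c1.Adj x.1 y.1 → dist1 (f x) (f y) ≤ 1)
    (hP : ∀ x : X, Pushable X x.1 → f x = x) {i : ZMod n} (hT : Turn t i) :
    f (D.vertex i) = D.vertex i :=
  (D.pushable_or_cusp hT).elim (hP (D.vertex i)) (D.cusp_fixed hf hP)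

/-- Between the nearest turning points on either side the curve is straight, and `f` does not
increase the `ℓ¹` distance to these fixed ends; `eq_of_dist1_opposite` leaves no room to move. -/
lemma curve_fixed (D : Disk t X) (hf : ∀ x y : X, c1.Adj x.1 y.1 → dist1 (f x) (f y) ≤ 1)
    (hd : ∀ x : X, dist1 x.1 (f x) ≤ 1)
    (hP : ∀ x : X, Pushable X x.1 → f x = x) (i : ZMod n) :
    f (D.vertex i) = D.vertex i := by
  by_cases hT : Turn t i
  · exact D.turn_fixed hf hP hT
  rw [Turn, ne_eq, not_not] at hT
  obtain ⟨K, -, hTK, hK⟩ := D.exists_turn i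
  obtain ⟨M, -, hTM, hM⟩ := D.exists_turn_backward i
  have h1 := D.dist1_straight hf i K hK
  have h2 := D.reverse.dist1_straight hf (-i) M (fun j hj => by
    have := hM j hj
    simp only [neg_add, neg_neg]
    simpa only [sub_eq_add_neg] using this)
  rw [D.turn_fixed hf hP hTK] at h1
  have e : D.reverse.vertex (-i + M) = D.vertex (i - M) :=
    Subtype.ext (by simp [vertex, sub_eq_add_neg, add_comm])
  have e' : D.reverse.vertex (-i) = D.vertex i := Subtype.ext (by simp [vertex])
  have e3 : t (i - 1) - t i = -(t (i + 1) - t i) := by rw [hT, neg_sub]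
  have e4 : dist1 0 (-(t (i + 1) - t i)) = dist1 0 (t (i + 1) - t i) := by
    simp [dist1, abs_sub_comm]
  rw [e, e', D.turn_fixed hf hP hTM] at h2
  simp only [neg_add, neg_neg] at h2
  rw [← sub_eq_add_neg, e3, e4] at h2
  refine Subtype.ext (eq_of_dist1_opposite (mem_directions (D.step i)) (hd _) (K := K) (M := M)
    ?_ ?_)
  · have := hK K le_rfl
    exact this ▸ h1
  · have := hM M le_rfl
    rw [e3] at this
    exact this ▸ h2

/-- A map of the disk that moves points by at most one and fixes all pushable points is the
identity. -/
theorem fixed (D : Disk t X) (hf : ∀ x y : X, c1.Adj x.1 y.1 → dist1 (f x) (f y) ≤ 1)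
    (hd : ∀ x : X, dist1 x.1 (f x) ≤ 1)
    (hP : ∀ x : X, Pushable X x.1 → f x = x) (x : X) : f x = x := by
  by_contra hne
  set e : Plane := (f x).1 - x.1 with he
  have he0 : e ≠ 0 := by
    rw [he, ne_eq, sub_eq_zero, ← Subtype.ext_iff]
    exact hne
  obtain ⟨m, hm⟩ := D.exists_notMem_ray x.1 (-e) (neg_ne_zero.2 he0)
  have hx := hd x
  -- If `z` moves to `z + e`, then `z` is off the curve and `z - e` is in `X`. The image of `z - e`
  -- is within one of both `z - e` and `z + e`, so it is their midpoint `z`.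
  suffices H : ∀ m : ℕ, ∃ h : x.1 + m • (-e) ∈ X, (f ⟨_, h⟩).1 = x.1 + m • (-e) + e from
    hm (H m).1
  intro m
  induction m with
  | zero => exact ⟨by simp, by simp [he]⟩
  | succ m ih =>
    obtain ⟨h, hfm⟩ := ih
    have hr : x.1 + m • (-e) ∉ Set.range t := by
      rintro ⟨k, hk⟩
      have h1 := D.curve_fixed hf hd hP k
      have h2 : D.vertex k = ⟨_, h⟩ := Subtype.ext hk
      rw [h2] at h1
      rw [h1] at hfm
      exact he0 (by simpa using hfm)
    have hs : x.1 + (m + 1) • (-e) = x.1 + m • (-e) - e := by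
      rw [add_smul, one_smul]; abel
    have hadj : c1.Adj (x.1 + m • (-e)) (x.1 + (m + 1) • (-e)) := by
      rw [hs]
      rw [dist1_le_one_iff, c1_adj_iff] at hx
      rcases hx with hx | hx
      · exact absurd (by rw [he, hx, sub_self]) he0
      · rw [c1_adj_iff]
        simp only [he, Prod.fst_sub, Prod.snd_sub]
        omega
    refine ⟨D.inside _ h hr _ hadj, ?_⟩
    have h1 := hf ⟨_, h⟩ ⟨_, D.inside _ h hr _ hadj⟩ hadj
    have h2 := hd ⟨_, D.inside _ h hr _ hadj⟩
    rw [hfm] at h1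
    generalize (f ⟨_, D.inside _ h hr _ hadj⟩).1 = y at *
    simp only [hs] at h2 ⊢
    generalize x.1 + m • (-e) = z at *
    rw [dist1_le_one_iff, c1_adj_iff, Prod.ext_iff] at h1 h2
    rw [c1_adj_iff] at hadj
    simp only [hs, Prod.fst_sub, Prod.snd_sub, Prod.fst_add, Prod.snd_add, Prod.ext_iff] at *
    omega

end Disk

/-! ### Continuity and adjacency -/

section Maps

variable {V : Type*} {G : SimpleGraph V} {f : V → V}

lemma IsContinuous.eq_or_adj (hf : IsContinuous G f) {x y : V} (h : G.Adj x y) :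
    f x = f y ∨ G.Adj (f x) (f y) := by
  by_cases hne : f x = f y
  · exact Or.inl hne
  right
  have h1 := hf {x, y} (SimpleGraph.induce_pair_connected_of_adj h).preconnected
  obtain ⟨p⟩ := h1 ⟨f x, x, by simp, rfl⟩ ⟨f y, y, by simp, rfl⟩
  generalize hz : (⟨f y, y, by simp, rfl⟩ : f '' {x, y}) = z at p
  cases p with
  | nil => exact absurd (congrArg Subtype.val hz).symm hne
  | @cons _ u _ h' _ =>
    obtain ⟨_, u, hu, rfl⟩ := u
    rcases hu with rfl | rfl
    · exact absurd h' (SimpleGraph.irrefl _)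
    · exact h'

lemma isContinuous_of_eq_or_adj (h : ∀ x y, G.Adj x y → f x = f y ∨ G.Adj (f x) (f y)) :
    IsContinuous G f := by
  rintro Y hY ⟨_, a, ha, rfl⟩ ⟨_, b, hb, rfl⟩
  obtain ⟨p⟩ := hY ⟨a, ha⟩ ⟨b, hb⟩
  have key : ∀ (x y : Y), (G.induce Y).Walk x y →
      (G.induce (f '' Y)).Reachable ⟨f x, x, x.2, rfl⟩ ⟨f y, y, y.2, rfl⟩ := by
    intro x y p
    induction p with
    | nil => rfl
    | @cons u v w huv p ih =>
      refine SimpleGraph.Reachable.trans ?_ ih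
      rcases h _ _ huv with e | e
      · have : (⟨f u, u, u.2, rfl⟩ : f '' Y) = ⟨f v, v, v.2, rfl⟩ := Subtype.ext e
        rw [this]
      · exact SimpleGraph.Adj.reachable (G := G.induce (f '' Y)) e
  exact key _ _ p

lemma eq_or_adj_of_edist_le_one {x y : V} (h : G.edist x y ≤ (1 : ℕ)) : x = y ∨ G.Adj x y := by
  rw [Nat.cast_one, Order.le_one_iff] at h
  simpa using h

end Maps

/-- A cold set contains all pushable points. -/
lemma mem_of_pushable {X : Set Plane} {A : Set X} (hA : IsCold (c1.induce X) A) {x : X}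
    (hx : Pushable X x.1) : x ∈ A := by
  classical
  by_contra hxA
  obtain ⟨q, hq, hne, hadj, hN⟩ := hx
  -- Every edge at `x` goes to an edge at `q`, by the choice of `q`.
  have hc : IsContinuous (c1.induce X) (Function.update id x ⟨q, hq⟩) := by
    refine isContinuous_of_eq_or_adj fun y z h => ?_
    right
    by_cases hy : y = x
    · subst hy
      have hz : z ≠ y := h.ne'
      rw [Function.update_self, Function.update_of_ne hz]
      exact (hN z z.2 h).symm
    · rw [Function.update_of_ne hy]
      by_cases hz : z = x
      · subst hz
        rw [Function.update_self]
        exact hN y y.2 h.symm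
      · rw [Function.update_of_ne hz]
        exact h
  have := hA _ hc (fun a ha => by
    have hne : a ≠ x := by
      rintro rfl
      exact hxA ha
    rw [Function.update_of_ne hne]; rfl) x
  rw [Function.update_self] at this
  rcases eq_or_adj_of_edist_le_one this with h | h
  · exact hne (congrArg Subtype.val h).symm
  · exact hadj h

/-! ### Bounding curves -/

lemma cross_eq_zero_of_collinear {Y : Set Plane} (h : Collinear ℝ (toC '' Y)) {p q r : Plane}
    (hp : p ∈ Y) (hq : q ∈ Y) (hr : r ∈ Y) :
    (q - p).1 * (r - p).2 = (q - p).2 * (r - p).1 := by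
  obtain ⟨v, hv⟩ := (collinear_iff_of_mem (Set.mem_image_of_mem toC hp)).1 h
  obtain ⟨a, ha⟩ := hv _ (Set.mem_image_of_mem toC hq)
  obtain ⟨b, hb⟩ := hv _ (Set.mem_image_of_mem toC hr)
  simp only [toC, Complex.ext_iff, vadd_eq_add, Complex.add_re, Complex.add_im, Complex.real_smul,
    Complex.mul_re, Complex.mul_im, Complex.ofReal_re, Complex.ofReal_im, zero_mul, sub_zero,
    add_zero] at ha hb
  have : ((q.1 : ℝ) - p.1) * (r.2 - p.2) = (q.2 - p.2) * (r.1 - p.1) := by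
    rw [ha.1, ha.2, hb.1, hb.2]; ring
  simp only [Prod.fst_sub, Prod.snd_sub]
  exact_mod_cast this

namespace ClosedCurve

variable {S : ClosedCurve} {X : Set Plane}

lemma IsBoundingCurve.inside (h : S.IsBoundingCurve X) {p : Plane} (hp : p ∈ X)
    (hpS : p ∉ S.carrier) {q : Plane} (hq : c1.Adj p q) : q ∈ X := by
  rw [h.2] at hp ⊢
  by_cases hqS : q ∈ S.carrier
  · exact Or.inl hqS
  obtain ⟨h1, h2⟩ := hp.resolve_left hpS
  refine Or.inr ⟨hqS, ?_⟩
  have : S.complGraph.connectedComponentMk ⟨q, hqS⟩ = S.complGraph.connectedComponentMk ⟨p, h1⟩ :=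
    SimpleGraph.ConnectedComponent.eq.2
      (SimpleGraph.Adj.reachable (G := S.complGraph) (u := ⟨q, hqS⟩) (v := ⟨p, h1⟩) hq.symm)
  rwa [this]

lemma IsBoundingCurve.finite (h : S.IsBoundingCurve X) : X.Finite := by
  obtain ⟨⟨C, D, hC, hD, hE⟩, rfl⟩ := h
  refine (Set.finite_range S.pt).union ((hC.image Subtype.val).subset ?_)
  rintro p ⟨hp, hfin⟩
  refine ⟨⟨p, hp⟩, ?_, rfl⟩
  rcases hE (S.complGraph.connectedComponentMk ⟨p, hp⟩) with e | e
  · exact e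
  · rw [e] at hfin
    exact absurd hfin hD

lemma IsBoundingCurve.outside (h : S.IsBoundingCurve X) (W : Plane → ℤ)
    (hW : ∀ p q, c1.Adj p q → p ∉ S.carrier → q ∉ S.carrier → W p = W q)
    {p q : Plane} (hp : p ∉ X) (hq : q ∉ X) : W p = W q := by
  obtain ⟨⟨C, D, hC, hD, hE⟩, rfl⟩ := h
  have key : ∀ p : Plane, p ∉ S.carrier ∪ S.interior →
      ∃ h : p ∈ S.carrierᶜ, S.complGraph.connectedComponentMk ⟨p, h⟩ = D := by
    intro p hp
    have h1 : p ∈ S.carrierᶜ := fun h => hp (Or.inl h)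
    refine ⟨h1, (hE _).resolve_left fun e => hp (Or.inr ⟨h1, ?_⟩)⟩
    rwa [e]
  obtain ⟨hp1, hp2⟩ := key p hp
  obtain ⟨hq1, hq2⟩ := key q hq
  obtain ⟨w⟩ := SimpleGraph.ConnectedComponent.eq.1 (hp2.trans hq2.symm)
  have hwalk : ∀ x y : ↥(S.carrierᶜ), S.complGraph.Walk x y → W x = W y := by
    intro x y w
    induction w with
    | nil => rfl
    | @cons u v _ huv _ ih => exact (hW _ _ huv u.2 v.2).trans ih
  exact hwalk _ _ w

lemma IsBoundingCurve.exists_interior (h : S.IsBoundingCurve X) : ∃ p ∈ X, p ∉ S.carrier := by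
  obtain ⟨⟨C, D, hC, hD, hE⟩, rfl⟩ := h
  obtain ⟨p, rfl⟩ := C.exists_rep
  exact ⟨p, Or.inr ⟨p.2, hC⟩, p.2⟩

/-- From an interior point the curve can be reached in each direction. -/
lemma IsBoundingCurve.exists_pt_ray (h : S.IsBoundingCurve X) {p : Plane} (hp : p ∈ X)
    (hpS : p ∉ S.carrier) {e : Plane} (he : c1.Adj 0 e) :
    ∃ (i : ZMod S.len) (m : ℕ), 1 ≤ m ∧ S.pt i = p + m • e := by
  by_contra! hc
  have hX : ∀ m : ℕ, p + m • e ∈ X ∧ p + m • e ∉ S.carrier := by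
    intro m
    induction m with
    | zero => simpa using ⟨hp, hpS⟩
    | succ m ih =>
      refine ⟨h.inside ih.1 ih.2 ?_, ?_⟩
      · rw [c1_adj_iff] at he ⊢
        simp only [add_smul, one_smul, Prod.fst_add, Prod.snd_add, Prod.fst_zero,
          Prod.snd_zero] at he ⊢
        omega
      · rintro ⟨i, hi⟩
        exact hc i (m + 1) (by omega) hi
  refine Set.infinite_of_injective_forall_mem (f := fun m : ℕ => p + m • e) ?_
    (fun m => (hX m).1) h.finite
  intro a b hab
  by_contra hne
  have h0 : e = 0 := by
    refine Prod.ext ?_ ?_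
    · have := congrArg Prod.fst hab
      simpa [hne] using this
    · have := congrArg Prod.snd hab
      simpa [hne] using this
  rw [h0] at he
  exact SimpleGraph.irrefl _ he

lemma step_fst_le (S : ClosedCurve) (i : ZMod S.len) :
    (S.pt i).1 - (S.pt (i + 1)).1 ≤ 1 ∧ (S.pt (i + 1)).1 - (S.pt i).1 ≤ 1 := by
  rcases S.step i with h | h
  · rw [← h]; omega
  · rw [c2_adj_iff] at h; omega

/-- The curve has points strictly left and right of an interior point, with abscissas at least two
apart; on a cycle of at most three points any two are equal or consecutive. -/
lemma IsBoundingCurve.four_le (h : S.IsBoundingCurve X) : 4 ≤ S.len := by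
  obtain ⟨p, hp, hpS⟩ := h.exists_interior
  obtain ⟨i, m, hm, hi⟩ := h.exists_pt_ray hp hpS (e := (1, 0)) (by simp [c1_adj_iff])
  obtain ⟨j, k, hk, hj⟩ := h.exists_pt_ray hp hpS (e := (-1, 0)) (by simp [c1_adj_iff])
  by_contra! hlt
  have hij : j = i ∨ j = i + 1 ∨ i = j + 1 := by
    have key : ∀ n : ℕ, n ≠ 0 → n < 4 → ∀ i j : ZMod n, j = i ∨ j = i + 1 ∨ i = j + 1 := by
      intro n h0 h4
      have : n = 1 ∨ n = 2 ∨ n = 3 := by omega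
      rcases this with rfl | rfl | rfl <;> decide
    exact key _ S.len_ne_zero.out hlt i j
  have hij' : (S.pt i).1 - (S.pt j).1 ≤ 1 := by
    rcases hij with e | e | e
    · rw [e]; omega
    · rw [e]; exact (S.step_fst_le i).1
    · rw [e]; exact (S.step_fst_le j).2
  rw [hi, hj] at hij'
  simp at hij'
  omega

/-- The stationary alternative in `step` can occur only on a curve of length one. -/
lemma adj_step (S : ClosedCurve) (h : 4 ≤ S.len) (i : ZMod S.len) :
    c2.Adj (S.pt i) (S.pt (i + 1)) := by
  refine (S.step i).resolve_left fun e => ?_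
  have := S.injective e
  have : Fact (1 < S.len) := ⟨by omega⟩
  simp at *

lemma cross_ne_zero_of_turn (S : ClosedCurve) (h : 4 ≤ S.len) {i : ZMod S.len}
    (hT : Turn S.pt i) : (S.pt (i + 1) - S.pt i).1 * (S.pt (i - 1) - S.pt i).2 ≠
      (S.pt (i + 1) - S.pt i).2 * (S.pt (i - 1) - S.pt i).1 := by
  have m1 := mem_directions (S.adj_step h i)
  have m2 := mem_directions (S.adj_step h (i - 1)).symm
  rw [sub_add_cancel] at m2
  have n1 : S.pt (i + 1) - S.pt i ≠ S.pt (i - 1) - S.pt i := by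
    intro e
    have e := sub_eq_zero.2 (S.injective (sub_left_inj.1 e))
    have e' : ((2 : ℕ) : ZMod S.len) = 0 := by
      push_cast
      rw [← e]; ring
    rw [ZMod.natCast_eq_zero_iff] at e'
    have := Nat.le_of_dvd two_pos e'
    omega
  have n2 : S.pt (i + 1) - S.pt i ≠ -(S.pt (i - 1) - S.pt i) := by
    rw [neg_sub]; exact hT
  have key : ∀ d ∈ directions, ∀ d' ∈ directions, d ≠ d' → d ≠ -d' →
      d.1 * d'.2 ≠ d.2 * d'.1 := by
    decide
  exact key _ m1 _ m2 n1 n2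

lemma pt_mem_arc (S : ClosedCurve) (i : ZMod S.len) {j k : ℕ} (h : j ≤ k) :
    S.pt (i + j) ∈ S.arc i k := ⟨j, h, rfl⟩

lemma toC_add_smul (p d : Plane) (j : ℕ) : toC (p + j • d) = (j : ℝ) • toC d +ᵥ toC p := by
  apply Complex.ext <;> simp [toC] <;> ring

/-- A straight arc is a digital line segment. -/
lemma isSegment_arc (S : ClosedCurve) (h : 4 ≤ S.len) {i : ZMod S.len} {K : ℕ} (hK : 1 ≤ K)
    (hs : ∀ j : ℕ, j ≤ K → S.pt (i + j) = S.pt i + j • (S.pt (i + 1) - S.pt i)) :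
    IsSegment (S.arc i K) := by
  have hi : S.pt i ∈ S.arc i K := ⟨0, by omega, by simp⟩
  refine ⟨(Set.finite_range S.pt).subset ?_, ⟨S.pt i, hi, S.pt (i + 1), ⟨1, hK, by simp⟩,
    (S.adj_step h i).ne⟩, Or.inr ?_, ?_⟩
  · rintro _ ⟨j, -, rfl⟩
    exact ⟨_, rfl⟩
  · have key : ∀ j : ℕ, ∀ hj : j ≤ K, (c2.induce (S.arc i K)).Reachable ⟨S.pt i, hi⟩
        ⟨S.pt (i + j), S.pt_mem_arc i hj⟩ := by
      intro j
      induction j with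
      | zero => intro hj; simp
      | succ j ih =>
        intro hj
        refine (ih (by omega)).trans (SimpleGraph.Adj.reachable ?_)
        have := S.adj_step h (i + j)
        rw [add_assoc] at this
        simpa using this
    rw [SimpleGraph.connected_iff_exists_forall_reachable]
    refine ⟨⟨S.pt i, hi⟩, ?_⟩
    rintro ⟨_, j, hj, rfl⟩
    exact key j hj
  · rw [collinear_iff_of_mem (Set.mem_image_of_mem toC hi)]
    refine ⟨toC (S.pt (i + 1) - S.pt i), ?_⟩
    rintro _ ⟨_, ⟨j, hj, rfl⟩, rfl⟩
    exact ⟨j, by rw [hs j hj, toC_add_smul]⟩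

/-- The points at which the curve turns are endpoints of its sides. -/
lemma mem_sideEndpoints_of_turn (S : ClosedCurve) (h : 4 ≤ S.len) {i : ZMod S.len}
    (hT : Turn S.pt i) : S.pt i ∈ S.sideEndpoints := by
  obtain ⟨K, hK, hTK, hs⟩ := exists_turn_of_injective (by omega) S.injective i
  refine ⟨i, K, ⟨S.isSegment_arc h hK hs, ?_⟩, Or.inl rfl⟩
  -- A longer arc would have to contain the curve point just before or just after the stretch, and
  -- the turns there make these non-collinear with it.
  intro i' k' hseg hsub
  refine Set.Subset.antisymm ?_ hsub
  have hi : S.pt i ∈ S.arc i' k' := hsub ⟨0, by omega, by simp⟩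
  have hi1 : S.pt (i + 1) ∈ S.arc i' k' := hsub ⟨1, hK, by simp⟩
  have hcol := hseg.2.2.2
  have hprev : S.pt (i - 1) ∉ S.arc i' k' := fun hp =>
    S.cross_ne_zero_of_turn h hT (cross_eq_zero_of_collinear hcol hi hi1 hp)
  have hnext : S.pt (i + K + 1) ∉ S.arc i' k' := fun hp =>
    S.cross_ne_zero_of_turn h hTK (cross_eq_zero_of_collinear hcol (hsub (S.pt_mem_arc i le_rfl))
      hp (hsub ⟨K - 1, by omega, by
        rw [Nat.cast_sub hK, Nat.cast_one, add_sub_assoc]⟩))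
  obtain ⟨j, hj, e⟩ := hi
  have e := S.injective e
  have hj0 : j = 0 := by
    by_contra hne
    refine hprev ⟨j - 1, by omega, ?_⟩
    rw [e, Nat.cast_sub (by omega), Nat.cast_one, add_sub_assoc]
  rw [hj0, Nat.cast_zero, add_zero] at e
  subst e
  rintro _ ⟨l, hl, rfl⟩
  refine S.pt_mem_arc i ?_
  by_contra! hlK
  refine hnext ⟨K + 1, by omega, ?_⟩
  rw [Nat.cast_add, Nat.cast_one, add_assoc]

end ClosedCurve

/-! ### Extreme points of the hull and the reduction to `Disk`. -/

lemma toC_injective : Function.Injective toC := by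
  intro p q h
  simp only [toC, Complex.ext_iff, Int.cast_inj] at h
  exact Prod.ext h.1 h.2

/-- An extreme point of the convex hull is not between two points of the set. -/
lemma eq_zero_of_extreme {X : Set Plane} {v w : Plane}
    (hv : toC v ∈ (convexHull ℝ (toC '' X)).extremePoints ℝ) {k l : ℕ} (hk : 0 < k) (hl : 0 < l)
    (h1 : v + k • w ∈ X) (h2 : v - l • w ∈ X) : w = 0 := by
  have := (mem_extremePoints.1 hv).2 _ (subset_convexHull ℝ _ (Set.mem_image_of_mem toC h1)) _
    (subset_convexHull ℝ _ (Set.mem_image_of_mem toC h2)) ?_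
  · have e := toC_injective this.1
    rw [add_eq_left, smul_eq_zero] at e
    exact e.resolve_left hk.ne'
  · have hk' : (0 : ℝ) < k := by exact_mod_cast hk
    have hl' : (0 : ℝ) < l := by exact_mod_cast hl
    -- These weights cancel `w`: `l * k - k * l = 0`.
    refine ⟨l / (k + l), k / (k + l), by positivity, by positivity, by field_simp; ring, ?_⟩
    apply Complex.ext <;>
    simp only [toC, Complex.add_re, Complex.add_im, Complex.smul_re, Complex.smul_im, smul_eq_mul,
      Prod.fst_add, Prod.snd_add, Prod.fst_sub, Prod.snd_sub, nsmul_eq_mul, Prod.fst_mul,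
      Prod.snd_mul, Prod.fst_natCast, Prod.snd_natCast, Int.cast_add, Int.cast_sub, Int.cast_mul,
      Int.cast_natCast] <;>
    field_simp <;> ring

/-- A digital disk that is digitally convex has a bounding curve that turns at extreme points. -/
lemma exists_disk {X : Set Plane} (hthick : IsThickDisk X) (hconvex : IsDigitallyConvex X) :
    ∃ S : ClosedCurve, Disk S.pt X := by
  obtain ⟨S, hS, -⟩ := hthick
  obtain ⟨p, hp, hpS⟩ := hS.exists_interior
  -- An interior point with its right and upper neighbours is a non-collinear triple, which excludes
  -- points and segments.
  have hr : p + (1, 0) ∈ X := hS.inside hp hpS (by simp [c1_adj_iff])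
  have hu : p + (0, 1) ∈ X := hS.inside hp hpS (by simp [c1_adj_iff])
  rcases hconvex with ⟨q, rfl⟩ | hseg | ⟨T, hT, hext⟩
  · rw [Set.mem_singleton_iff] at hp hr
    rw [hp] at hr
    simp at hr
  · have := cross_eq_zero_of_collinear hseg.2.2.2 hp hr hu
    simp at this
  · have h4 := hT.four_le
    -- The disk is built on the curve `T` from convexity, because the sides of `T` are those known
    -- to end at extreme points.
    refine ⟨T, h4, T.injective, T.adj_step h4, fun i => ?_, hT.finite,
      fun p hp hpT q hq => hT.inside hp hpT hq, fun W hW p hp q hq => hT.outside W hW hp hq,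
      fun i hi w k l hk hl h1 h2 => eq_zero_of_extreme ?_ hk hl h1 h2⟩
    · rw [hT.2]
      exact Or.inl ⟨i, rfl⟩
    · rw [← hext]
      exact Set.mem_image_of_mem toC (T.mem_sideEndpoints_of_turn h4 hi)

/-- In a thick, digitally convex disk, cold sets are freezing sets. -/
lemma isFreezing_of_isCold {X : Set Plane} (hthick : IsThickDisk X)
    (hconvex : IsDigitallyConvex X) {A : Set X} (hA : IsCold (c1.induce X) A) :
    IsFreezing (c1.induce X) A := by
  intro f hf hfix
  obtain ⟨S, D⟩ := exists_disk hthick hconvex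
  funext x
  refine D.fixed (fun x y h => ?_) (fun x => ?_) (fun x hx => hfix _ (mem_of_pushable hA hx)) x
  · rw [dist1_le_one_iff]
    exact (hf.eq_or_adj (show (c1.induce X).Adj x y from h)).imp
      (fun e => congrArg Subtype.val e.symm) id
  · rw [dist1_le_one_iff]
    exact (eq_or_adj_of_edist_le_one (hA f hf hfix x)).imp
      (fun e => congrArg Subtype.val e.symm) id

end DigitalImage

theorem theorem6p3 (X : Set DigitalImage.Plane) (hthick : DigitalImage.IsThickDisk X)
    (hconvex : DigitalImage.IsDigitallyConvex X) (A : Set X) :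
    DigitalImage.IsCold (DigitalImage.c1.induce X) A ↔
      DigitalImage.IsFreezing (DigitalImage.c1.induce X) A := by
  refine ⟨DigitalImage.isFreezing_of_isCold hthick hconvex, fun h f hf hfix x => ?_⟩
  rw [h f hf hfix]
  simp
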